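/- Let $n\ge 0$ be an integer. A function $\varphi:\mathbb R^n\to[0,\infty]$ is called geometric convex if it is convex, lower semicontinuous and $\varphi(0)=0$. For functions $\varphi,\psi:\mathbb R^n\to[0,\infty]$ and $x,y\in\mathbb R^n$, put $$(\mathcal L\varphi)(y)=\sup_{x\in\mathbb R^n}\bigl(\langle x,y\rangle-\varphi(x)\bigr)_+,\qquad (\mathcal A\varphi)(y)=\sup_{x\in\mathbb R^n}\frac{(\langle x,y\rangle-1)_+}{\varphi(x)},\qquad \mathcal J=\mathcal A\mathcal L,$$ where $c_+=\max\{c,0\}$, $c/0=\infty$ for $c>0$, $0/0=0$ and $c/\infty=0$ for finite $c\ge0$ (for geometric convex $\varphi$, $\mathcal L$ is the usual Legendre transform and $\mathcal A$ the polarity transform). Further put $$(\varphi\,\square\,\psi)(x)=\inf_{y\in\mathbb R^n}\bigl(\varphi(y)+\psi(x-y)\bigr),\qquad \varphi\boxdot\psi=\mathcal J(\mathcal J\varphi\,\square\,\mathcal J\psi),\qquad \varphi^-(x)=\varphi(-x).$$ **Proposition (Rogers–Shephard type inequality).** For every geometric convex function $\varphi:\mathbb R^n\to[0,\infty]$ with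 $0<\int_{\mathbb R^n}e^{-\varphi}<\infty$, the function $\varphi^-$ is again geometric convex with $0<\int_{\mathbb R^n}e^{-\varphi^-}<\infty$, and $$\int_{\mathbb R^n}e^{-(\varphi\boxdot\varphi^-)}\le 8^n\int_{\mathbb R^n}e^{-\varphi}.$$ -/

import Mathlib

open MeasureTheory Set
open scoped ENNReal NNReal

/-- The class `Cvx₀(ℝⁿ)` of geometric convex functions: lower semicontinuous convex functions
`ℝⁿ → [0, ∞]` vanishing at the origin. Convexity of a `[0, ∞]`-valued function is expressed with
nonnegative weights, with `0 • ∞ = 0`. -/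
structure IsGeomConvex {n : ℕ} (φ : EuclideanSpace ℝ (Fin n) → ℝ≥0∞) : Prop where
  convexOn : ConvexOn ℝ≥0 univ φ
  lowerSemicontinuous : LowerSemicontinuous φ
  map_zero : φ 0 = 0

/-- The integral `∫ e^{-φ}` over `ℝⁿ` (Lebesgue measure), as an element of `[0, ∞]`;
here `e^{-∞} = 0`. -/
noncomputable def integralExpNeg {n : ℕ} (φ : EuclideanSpace ℝ (Fin n) → ℝ≥0∞) : ℝ≥0∞ :=
  ∫⁻ x, EReal.exp (-(φ x : EReal))

/-- The class of those geometric convex functions `φ` with `0 < ∫ e^{-φ} < ∞`. -/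
structure IsGeomConvexIntegrable {n : ℕ} (φ : EuclideanSpace ℝ (Fin n) → ℝ≥0∞) : Prop
    extends IsGeomConvex φ where
  integral_pos : 0 < integralExpNeg φ
  integral_lt_top : integralExpNeg φ < ∞

/-- The Legendre transform `(ℒφ)(y) = sup_x (⟨x, y⟩ - φ(x))`. For `φ ≥ 0` with `φ 0 = 0` the
supremum is at least the value `0` of the term `x = 0`, so negative terms may be replaced by `0`,
as is done by the truncations in `[0, ∞]`. -/
noncomputable def legendre {n : ℕ} (φ : EuclideanSpace ℝ (Fin n) → ℝ≥0∞)
    (y : EuclideanSpace ℝ (Fin n)) : ℝ≥0∞ :=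
  ⨆ x, (ENNReal.ofReal (inner ℝ x y) - φ x)

/-- The polarity transform `(𝒜φ)(y) = sup_x (⟨x, y⟩ - 1) / φ(x)`, with the usual conventions:
`c / 0 = ∞` for `c > 0`, `c / ∞ = 0`, and terms with `c ≤ 0` do not contribute (they count as `0`,
so that `𝒜φ ≥ 0`). -/
noncomputable def polarity {n : ℕ} (φ : EuclideanSpace ℝ (Fin n) → ℝ≥0∞)
    (y : EuclideanSpace ℝ (Fin n)) : ℝ≥0∞ :=
  ⨆ x, (ENNReal.ofReal (inner ℝ x y - 1) / φ x)

/-- The gauge transform `𝒥 = 𝒜 ∘ ℒ`. -/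
noncomputable def gaugeTransform {n : ℕ} (φ : EuclideanSpace ℝ (Fin n) → ℝ≥0∞) :
    EuclideanSpace ℝ (Fin n) → ℝ≥0∞ :=
  polarity (legendre φ)

/-- The inf-convolution `(φ □ ψ)(x) = inf_y (φ(y) + ψ(x - y))`. -/
noncomputable def infConv {n : ℕ} (φ ψ : EuclideanSpace ℝ (Fin n) → ℝ≥0∞)
    (x : EuclideanSpace ℝ (Fin n)) : ℝ≥0∞ :=
  ⨅ y, (φ y + ψ (x - y))

/-- The g-inf-convolution `φ ⊡ ψ = 𝒥(𝒥φ □ 𝒥ψ)`. -/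
noncomputable def gInfConv {n : ℕ} (φ ψ : EuclideanSpace ℝ (Fin n) → ℝ≥0∞) :
    EuclideanSpace ℝ (Fin n) → ℝ≥0∞ :=
  gaugeTransform (infConv (gaugeTransform φ) (gaugeTransform ψ))

/-- The reflection `φ⁻(x) = φ(-x)`. -/
def reflection {n : ℕ} (φ : EuclideanSpace ℝ (Fin n) → ℝ≥0∞)
    (x : EuclideanSpace ℝ (Fin n)) : ℝ≥0∞ :=
  φ (-x)

/-! The inequality is proved level by level. For t > 0 let K = {φ ≤ t}; the claim is {φ ⊡ φ⁻ ≤ t} ⊆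
2·closure(K − K). If z lies outside the right side, separation gives x with ⟨x, ·⟩ ≤ 1 on K − K and
⟨x, z⟩ > 2. Let p be the supremum of ⟨x, ·⟩ on K; on −K it is at most 1 − p. Convexity turns these
bounds into affine minorants ⟨x, ·⟩ − c of 𝒥φ and ⟨x, ·⟩ − d of 𝒥φ⁻, with c + d arbitrarily close to
1/t. Hence ℒ(𝒥φ □ 𝒥φ⁻)(x) ≤ c + d, and testing 𝒥 at x gives a value above t at z.

Together with |K − K| ≤ 4ⁿ|K| this gives |{φ ⊡ φ⁻ ≤ t}| ≤ 8ⁿ|K|, and the layer-cake formula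
integrates it over t. -/

/-- Sublevel sets of a `ℝ≥0`-convex function are convex over `ℝ`. -/
theorem IsGeomConvex.convex_sublevel {n : ℕ} {φ : EuclideanSpace ℝ (Fin n) → ℝ≥0∞}
    (hφ : IsGeomConvex φ) (t : ℝ≥0∞) : Convex ℝ {x | φ x ≤ t} := by
  intro x hx y hy a b ha hb hab
  lift a to ℝ≥0 using ha
  lift b to ℝ≥0 using hb
  have hab' : a + b = 1 := by exact_mod_cast hab
  have := (hφ.convexOn.convex_le t) (x := x) ⟨mem_univ _, hx⟩ (y := y) ⟨mem_univ _, hy⟩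
    (zero_le (a := a)) (zero_le (a := b)) hab'
  exact this.2

theorem IsGeomConvex.map_smul_le {n : ℕ} {φ : EuclideanSpace ℝ (Fin n) → ℝ≥0∞}
    (hφ : IsGeomConvex φ) {a : ℝ≥0} (ha : a ≤ 1) (x : EuclideanSpace ℝ (Fin n)) :
    φ ((a : ℝ) • x) ≤ a * φ x := by
  have := hφ.convexOn.2 (mem_univ x) (mem_univ (0 : EuclideanSpace ℝ (Fin n)))
    (zero_le (a := a)) (zero_le (a := 1 - a)) (add_tsub_cancel_of_le ha)
  rw [smul_zero, add_zero, hφ.map_zero, smul_zero, add_zero] at this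
  exact this

/-! ### Affine minorants of gauge transforms -/

/-- If `⟨x, u⟩ ≤ 1 + c φ(u)` for all `u`, then `⟨x, a⟩ ≤ (𝒥φ)(a) + c` for all `a`. -/
theorem inner_le_gaugeTransform_add {n : ℕ} {φ : EuclideanSpace ℝ (Fin n) → ℝ≥0∞}
    {x : EuclideanSpace ℝ (Fin n)} {c : ℝ} (hc : 0 < c)
    (h : ∀ u, ENNReal.ofReal (inner ℝ x u) ≤ 1 + ENNReal.ofReal c * φ u)
    (a : EuclideanSpace ℝ (Fin n)) :
    ENNReal.ofReal (inner ℝ x a) ≤ gaugeTransform φ a + ENNReal.ofReal c := by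
  -- The polarity supremum is tested at c⁻¹x, where dividing the hypothesis by c bounds ℒφ.
  have hL : legendre φ (c⁻¹ • x) ≤ ENNReal.ofReal c⁻¹ := by
    refine iSup_le fun u => ?_
    rw [tsub_le_iff_right, inner_smul_right, ENNReal.ofReal_mul (by positivity),
      real_inner_comm]
    calc ENNReal.ofReal c⁻¹ * ENNReal.ofReal (inner ℝ x u)
        ≤ ENNReal.ofReal c⁻¹ * (1 + ENNReal.ofReal c * φ u) := by gcongr; exact h u
      _ = ENNReal.ofReal c⁻¹ + φ u := by
        rw [mul_add, mul_one, ← mul_assoc, ← ENNReal.ofReal_mul (by positivity),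
          inv_mul_cancel₀ hc.ne', ENNReal.ofReal_one, one_mul]
  have hJ : ENNReal.ofReal (inner ℝ x a - c) ≤ gaugeTransform φ a := by
    calc ENNReal.ofReal (inner ℝ x a - c)
        = ENNReal.ofReal (inner ℝ (c⁻¹ • x) a - 1) / ENNReal.ofReal c⁻¹ := by
          rw [← ENNReal.ofReal_div_of_pos (by positivity), real_inner_smul_left]
          congr 1
          field_simp
      _ ≤ ENNReal.ofReal (inner ℝ (c⁻¹ • x) a - 1) / legendre φ (c⁻¹ • x) := by gcongr
      _ ≤ gaugeTransform φ a :=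
          le_iSup (fun w => ENNReal.ofReal (inner ℝ w a - 1) / legendre φ w) (c⁻¹ • x)
  calc ENNReal.ofReal (inner ℝ x a) = ENNReal.ofReal ((inner ℝ x a - c) + c) := by
        rw [sub_add_cancel]
    _ ≤ ENNReal.ofReal (inner ℝ x a - c) + ENNReal.ofReal c := ENNReal.ofReal_add_le
    _ ≤ _ := by gcongr

/-- A linear functional bounded by `p ≤ 1` on the sublevel set `{φ ≤ t}` satisfies
`⟨x, u⟩ ≤ 1 + c φ(u)` for every `c ≥ p / t`. -/
theorem IsGeomConvex.inner_le_one_add {n : ℕ} {φ : EuclideanSpace ℝ (Fin n) → ℝ≥0∞}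
    (hφ : IsGeomConvex φ) {x : EuclideanSpace ℝ (Fin n)} {t p c : ℝ} (ht : 0 < t) (hp : p ≤ 1)
    (hc : 0 < c) (hpc : p ≤ t * c)
    (h : ∀ u, φ u ≤ ENNReal.ofReal t → inner ℝ x u ≤ p) (u : EuclideanSpace ℝ (Fin n)) :
    ENNReal.ofReal (inner ℝ x u) ≤ 1 + ENNReal.ofReal c * φ u := by
  by_cases hu : φ u ≤ ENNReal.ofReal t
  · calc ENNReal.ofReal (inner ℝ x u) ≤ ENNReal.ofReal 1 :=
          ENNReal.ofReal_le_ofReal ((h u hu).trans hp)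
      _ ≤ _ := by rw [ENNReal.ofReal_one]; exact le_self_add
  · push Not at hu
    rcases eq_or_ne (φ u) ∞ with hi | hi
    · rw [hi, ENNReal.mul_top (by simpa using hc)]
      simp
    set r : ℝ := (φ u).toReal with hr
    have hur : φ u = ENNReal.ofReal r := (ENNReal.ofReal_toReal hi).symm
    have htr : t < r := by
      rw [hur] at hu
      exact (ENNReal.ofReal_lt_ofReal_iff_of_nonneg ht.le).1 hu
    have hr0 : 0 < r := ht.trans htr
    -- Beyond level t, u is shrunk by t / r into the sublevel set, so ⟨x, u⟩ ≤ pr/t ≤ cr.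
    have h1 : φ ((t / r) • u) ≤ ENNReal.ofReal t := by
      have := hφ.map_smul_le (a := (t / r).toNNReal)
        (by rw [Real.toNNReal_le_one]; exact (div_le_one hr0).2 htr.le) u
      rw [Real.coe_toNNReal _ (by positivity), hur] at this
      refine this.trans_eq ?_
      change ENNReal.ofReal (t / r) * _ = _
      rw [← ENNReal.ofReal_mul (by positivity), div_mul_cancel₀ _ hr0.ne']
    have h2 := h _ h1
    rw [inner_smul_right, div_mul_eq_mul_div, div_le_iff₀ hr0] at h2
    have h3 : inner ℝ x u ≤ c * r := by
      refine le_of_mul_le_mul_left (h2.trans ?_) ht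
      calc p * r ≤ t * c * r := by gcongr
        _ = _ := by ring
    calc ENNReal.ofReal (inner ℝ x u) ≤ ENNReal.ofReal (c * r) := ENNReal.ofReal_le_ofReal h3
      _ = ENNReal.ofReal c * φ u := by rw [ENNReal.ofReal_mul hc.le, hur]
      _ ≤ _ := le_add_self

/-- The Legendre transform of an inf-convolution is at most the sum of the bounds for the
two functions. -/
theorem legendre_infConv_le {n : ℕ} {f g : EuclideanSpace ℝ (Fin n) → ℝ≥0∞}
    {x : EuclideanSpace ℝ (Fin n)} {c d : ℝ≥0∞}
    (hf : ∀ a, ENNReal.ofReal (inner ℝ x a) ≤ f a + c)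
    (hg : ∀ a, ENNReal.ofReal (inner ℝ x a) ≤ g a + d) :
    legendre (infConv f g) x ≤ c + d := by
  refine iSup_le fun y => ?_
  rw [tsub_le_iff_left, infConv, ENNReal.iInf_add]
  refine le_iInf fun a => ?_
  calc ENNReal.ofReal (inner ℝ y x)
      = ENNReal.ofReal (inner ℝ x a + inner ℝ x (y - a)) := by
        rw [← inner_add_right, add_sub_cancel, real_inner_comm]
    _ ≤ ENNReal.ofReal (inner ℝ x a) + ENNReal.ofReal (inner ℝ x (y - a)) :=
        ENNReal.ofReal_add_le
    _ ≤ (f a + c) + (g (y - a) + d) := add_le_add (hf a) (hg _)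
    _ = _ := by ring

/-! ### Sublevel sets of φ ⊡ φ⁻ -/

open scoped Pointwise in
theorem IsGeomConvex.gInfConv_sublevel_subset {n : ℕ} {φ : EuclideanSpace ℝ (Fin n) → ℝ≥0∞}
    (hφ : IsGeomConvex φ) (hφ' : IsGeomConvex (reflection φ)) {t : ℝ} (ht : 0 < t) :
    {z | gInfConv φ (reflection φ) z ≤ ENNReal.ofReal t} ⊆
      (2 : ℝ) • closure ({x | φ x ≤ ENNReal.ofReal t} - {x | φ x ≤ ENNReal.ofReal t}) := by
  set K := {x | φ x ≤ ENNReal.ofReal t} with hK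
  have hKc : Convex ℝ K := hφ.convex_sublevel _
  have h0 : (0 : EuclideanSpace ℝ (Fin n)) ∈ K := by simp [hK, hφ.map_zero]
  intro z hz
  by_contra hzC
  rw [mem_smul_set_iff_inv_smul_mem₀ two_ne_zero] at hzC
  obtain ⟨f, s, hfs, hsz⟩ :=
    geometric_hahn_banach_closed_point (hKc.sub hKc).closure isClosed_closure hzC
  have hs : 0 < s := by
    simpa using hfs 0 (subset_closure ⟨0, h0, 0, h0, sub_zero 0⟩)
  set x := s⁻¹ • (InnerProductSpace.toDual ℝ (EuclideanSpace ℝ (Fin n))).symm f with hx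
  have hxf : ∀ u, inner ℝ x u = s⁻¹ * f u := fun u => by
    rw [hx, real_inner_smul_left, InnerProductSpace.toDual_symm_apply]
  have hsub : ∀ u ∈ K, ∀ v ∈ K, inner ℝ x u - inner ℝ x v ≤ 1 := fun u hu v hv => by
    have := hfs _ (subset_closure (sub_mem_sub hu hv))
    rw [hxf, hxf, ← mul_sub, ← map_sub, inv_mul_le_iff₀ hs, mul_one]
    exact this.le
  have hxz : 2 < inner ℝ x z := by
    rw [map_smul, smul_eq_mul] at hsz
    rw [hxf, lt_inv_mul_iff₀ hs]
    linarith
  set p := sSup ((fun u => (inner ℝ x u : ℝ)) '' K) with hp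
  have hup : ∀ u ∈ K, inner ℝ x u ≤ p := fun u hu => by
    refine le_csSup ⟨1, ?_⟩ (mem_image_of_mem _ hu)
    rintro _ ⟨v, hv, rfl⟩
    simpa using hsub v hv 0 h0
  have hpv : ∀ v ∈ K, p ≤ 1 + inner ℝ x v := fun v hv => by
    refine csSup_le ⟨_, mem_image_of_mem _ h0⟩ ?_
    rintro _ ⟨u, hu, rfl⟩
    linarith [hsub u hu v hv]
  have hp0 : 0 ≤ p := by simpa using hup 0 h0
  have hp1 : p ≤ 1 := by simpa using hpv 0 h0
  -- The slack ε keeps c = p/t + ε and d = (1 − p)/t + ε positive when p is 0 or 1. Since 4tε = ⟨x,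
  -- z⟩ − 2, still t(c + d) = 1 + 2tε < ⟨x, z⟩ − 1.
  set ε := (inner ℝ x z - 2) / (4 * t) with hε
  have hε0 : 0 < ε := div_pos (by linarith) (by linarith)
  have hεt : 4 * t * ε = inner ℝ x z - 2 := by rw [hε]; field_simp
  have hc : 0 < p / t + ε := by positivity
  have hd : 0 < (1 - p) / t + ε := add_pos_of_nonneg_of_pos (div_nonneg (by linarith) ht.le) hε0
  have hL : legendre (infConv (gaugeTransform φ) (gaugeTransform (reflection φ))) x ≤
      ENNReal.ofReal (p / t + ε + ((1 - p) / t + ε)) := by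
    rw [ENNReal.ofReal_add hc.le hd.le]
    refine legendre_infConv_le
      (inner_le_gaugeTransform_add hc (hφ.inner_le_one_add ht hp1 hc ?_ hup))
      (inner_le_gaugeTransform_add hd
        (hφ'.inner_le_one_add (p := 1 - p) ht (by linarith) hd ?_ fun u hu => ?_))
    · rw [mul_add, mul_div_cancel₀ _ ht.ne']
      linarith [mul_pos ht hε0]
    · rw [mul_add, mul_div_cancel₀ _ ht.ne']
      linarith [mul_pos ht hε0]
    · have := hpv (-u) hu
      rw [inner_neg_right] at this
      linarith
  have hcd : 0 < p / t + ε + ((1 - p) / t + ε) := add_pos hc hd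
  have hlt : t < (inner ℝ x z - 1) / (p / t + ε + ((1 - p) / t + ε)) := by
    rw [lt_div_iff₀ hcd]
    have : t * (p / t + ε + ((1 - p) / t + ε)) = 1 + 2 * (t * ε) := by
      field_simp
      ring
    rw [this]
    linarith
  refine absurd (show gInfConv φ (reflection φ) z ≤ ENNReal.ofReal t from hz) (not_le.2 ?_)
  calc ENNReal.ofReal t
      < ENNReal.ofReal ((inner ℝ x z - 1) / (p / t + ε + ((1 - p) / t + ε))) :=
        (ENNReal.ofReal_lt_ofReal_iff_of_nonneg ht.le).2 hlt
    _ = ENNReal.ofReal (inner ℝ x z - 1) / ENNReal.ofReal (p / t + ε + ((1 - p) / t + ε)) :=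
        ENNReal.ofReal_div_of_pos hcd
    _ ≤ ENNReal.ofReal (inner ℝ x z - 1) /
        legendre (infConv (gaugeTransform φ) (gaugeTransform (reflection φ))) x := by gcongr
    _ ≤ _ := le_iSup (fun w => ENNReal.ofReal (inner ℝ w z - 1) /
        legendre (infConv (gaugeTransform φ) (gaugeTransform (reflection φ))) w) x

/-! ### Volume of the difference body -/

open scoped Pointwise in
/-- A weak form of the Rogers–Shephard inequality for the difference body. -/
theorem volume_sub_self_le {n : ℕ} {K : Set (EuclideanSpace ℝ (Fin n))} (hK : Convex ℝ K)
    (hm : MeasurableSet K) (h0 : volume K ≠ 0) (hi : volume K ≠ ∞) :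
    volume (K - K) ≤ 4 ^ n * volume K := by
  have hfin : Module.finrank ℝ (EuclideanSpace ℝ (Fin n)) = n := by simp
  have hhalf : ∀ s : Set (EuclideanSpace ℝ (Fin n)),
      volume ((2⁻¹ : ℝ) • s) = (2 ^ n)⁻¹ * volume s := fun s => by
    rw [Measure.addHaar_smul, hfin, abs_of_pos (by positivity),
      ENNReal.ofReal_pow (by positivity), ENNReal.ofReal_inv_of_pos two_pos,
      ENNReal.ofReal_ofNat, ENNReal.inv_pow]
  -- The fibre of S over x is K ∩ (K + x), so S has measure |K|² by Fubini.
  set S : Set (EuclideanSpace ℝ (Fin n) × EuclideanSpace ℝ (Fin n)) :=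
    {q | q.2 ∈ K ∧ q.2 - q.1 ∈ K} with hS
  have hSm : MeasurableSet S :=
    (measurable_snd hm).inter ((measurable_snd.sub measurable_fst) hm)
  have hSv : (volume.prod volume) S = volume K * volume K := by
    rw [Measure.prod_apply_symm hSm, ← lintegral_indicator_const hm]
    refine lintegral_congr fun u => ?_
    by_cases hu : u ∈ K
    · rw [indicator_of_mem hu]
      have : (fun x => (x, u)) ⁻¹' S = (fun x => u - x) ⁻¹' K := by
        ext x
        simp [hS, hu]
      rw [this]
      exact (Measure.measurePreserving_sub_left volume u).measure_preimage hm.nullMeasurableSet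
    · rw [indicator_of_notMem hu]
      have : (fun x => (x, u)) ⁻¹' S = ∅ := by
        ext x
        simp [hS, hu]
      rw [this, measure_empty]
  -- Over x = (a − b)/2 the fibre contains the translate K/2 + a/2, by convexity.
  have hsub : (2⁻¹ : ℝ) • (K - K) ⊆
      {x | (2 ^ n)⁻¹ * volume K ≤ volume (Prod.mk x ⁻¹' S)} := by
    rintro _ ⟨_, ⟨a, ha, b, hb, rfl⟩, rfl⟩
    rw [mem_ofPred_eq, ← hhalf, ← measure_preimage_add_right volume (-((2⁻¹ : ℝ) • a))]
    refine measure_mono fun u hu => ?_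
    obtain ⟨k, hk, hku⟩ := hu
    have hu' : u = (2⁻¹ : ℝ) • k + (2⁻¹ : ℝ) • a := by
      rw [show (2⁻¹ : ℝ) • k = u + -((2⁻¹ : ℝ) • a) from hku]
      abel
    refine ⟨?_, ?_⟩
    · change u ∈ K
      rw [hu']
      exact hK hk ha (by norm_num) (by norm_num) (by norm_num)
    · change u - (2⁻¹ : ℝ) • (a - b) ∈ K
      have : u - (2⁻¹ : ℝ) • (a - b) = (2⁻¹ : ℝ) • k + (2⁻¹ : ℝ) • b := by
        rw [hu', smul_sub]
        abel
      rw [this]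
      exact hK hk hb (by norm_num) (by norm_num) (by norm_num)
  -- Markov's inequality for the fibre volume.
  have hmain : (2 ^ n)⁻¹ * volume K * ((2 ^ n)⁻¹ * volume (K - K)) ≤ volume K * volume K := by
    rw [← hSv, Measure.prod_apply hSm, ← hhalf (K - K)]
    exact (mul_le_mul_right (measure_mono hsub) _).trans
      (mul_meas_ge_le_lintegral (measurable_measure_prodMk_left hSm) _)
  have h2 : (2 : ℝ≥0∞) ^ n * (2 ^ n)⁻¹ = 1 :=
    ENNReal.mul_inv_cancel (by positivity) (by simp)
  refine (ENNReal.mul_le_mul_iff_right h0 hi).1 ?_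
  calc volume K * volume (K - K)
      = (2 ^ n * (2 ^ n)⁻¹) * (2 ^ n * (2 ^ n)⁻¹) * (volume K * volume (K - K)) := by
        rw [h2, one_mul, one_mul]
    _ = 2 ^ n * 2 ^ n * ((2 ^ n)⁻¹ * volume K * ((2 ^ n)⁻¹ * volume (K - K))) := by ring
    _ ≤ 2 ^ n * 2 ^ n * (volume K * volume K) := by gcongr
    _ = volume K * (4 ^ n * volume K) := by
      rw [← mul_pow]
      norm_num
      ring

/-! ### Measurability and the layer-cake comparison -/

theorem lowerSemicontinuous_polarity {n : ℕ} (φ : EuclideanSpace ℝ (Fin n) → ℝ≥0∞) :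
    LowerSemicontinuous (polarity φ) := by
  refine lowerSemicontinuous_iSup fun x => ?_
  have hc : Continuous fun y : EuclideanSpace ℝ (Fin n) => ENNReal.ofReal (inner ℝ x y - 1) :=
    ENNReal.continuous_ofReal.comp (by fun_prop)
  rcases eq_or_ne (φ x) 0 with h | h
  · intro y a ha
    rw [h] at ha
    have hy : ENNReal.ofReal (inner ℝ x y - 1) ≠ 0 := fun h0 => by simp [h0] at ha
    filter_upwards [hc.continuousAt.eventually_ne hy] with w hw
    simp only [h, ENNReal.div_zero hw]
    simpa only [ENNReal.div_zero hy] using ha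
  · exact ((ENNReal.continuous_div_const _ h).comp hc).lowerSemicontinuous

theorem exp_neg_coe_ennreal_le_one (a : ℝ≥0∞) : EReal.exp (-(a : EReal)) ≤ 1 := by
  simp [EReal.coe_ennreal_nonneg]

theorem exp_neg_coe_ennreal_eq (a : ℝ≥0∞) :
    EReal.exp (-(a : EReal)) = ENNReal.ofReal (EReal.exp (-(a : EReal))).toReal :=
  (ENNReal.ofReal_toReal
    (ne_top_of_le_ne_top ENNReal.one_ne_top (exp_neg_coe_ennreal_le_one a))).symm

theorem le_toReal_exp_neg_iff {a : ℝ≥0∞} {s : ℝ} (hs : 0 < s) (hs1 : s ≤ 1) :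
    s ≤ (EReal.exp (-(a : EReal))).toReal ↔ a ≤ ENNReal.ofReal (-Real.log s) := by
  induction a with
  | top => simp [hs]
  | coe r =>
    have : (((r : ℝ≥0∞) : EReal)) = ((r : ℝ) : EReal) := rfl
    rw [this, ← EReal.coe_neg, EReal.exp_coe, ENNReal.toReal_ofReal (Real.exp_pos _).le,
      ← Real.log_le_iff_le_exp hs, ENNReal.ofReal, ENNReal.coe_le_coe,
      Real.le_toNNReal_iff_coe_le (by linarith [Real.log_nonpos hs.le hs1])]
    constructor <;> intro h <;> linarith

theorem integralExpNeg_le_of_sublevel {n : ℕ} {f g : EuclideanSpace ℝ (Fin n) → ℝ≥0∞}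
    (hf : Measurable f) (hg : Measurable g) {C : ℝ≥0∞} (hC : C ≠ ∞)
    (h : ∀ t : ℝ, 0 < t → volume {x | f x ≤ ENNReal.ofReal t} ≤
      C * volume {x | g x ≤ ENNReal.ofReal t}) :
    integralExpNeg f ≤ C * integralExpNeg g := by
  have key : ∀ φ : EuclideanSpace ℝ (Fin n) → ℝ≥0∞, Measurable φ → integralExpNeg φ =
      ∫⁻ s in Ioi (0 : ℝ), volume {x | s ≤ (EReal.exp (-(φ x : EReal))).toReal} := by
    intro φ hφ
    rw [integralExpNeg, lintegral_congr fun x => exp_neg_coe_ennreal_eq (φ x)]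
    exact lintegral_eq_lintegral_meas_le _ (Filter.Eventually.of_forall fun x =>
      ENNReal.toReal_nonneg) (by fun_prop)
  rw [key f hf, key g hg, ← lintegral_const_mul' _ _ hC]
  refine lintegral_mono_ae ?_
  -- Superlevel s of e^{−φ} is sublevel t = −log s of φ; s = 1 gives t = 0, which `h` does not
  -- cover, and is discarded as a null set.
  filter_upwards [ae_restrict_mem measurableSet_Ioi,
    ae_restrict_of_ae (Measure.ae_ne volume (1 : ℝ))] with s hs hs1
  rcases lt_or_gt_of_ne hs1 with hlt | hgt
  · simp only [le_toReal_exp_neg_iff hs hlt.le]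
    exact h _ (by linarith [Real.log_neg hs hlt])
  · have : {x | s ≤ (EReal.exp (-(f x : EReal))).toReal} = ∅ := by
      refine eq_empty_of_forall_notMem fun x hx => ?_
      have := ENNReal.toReal_mono ENNReal.one_ne_top (exp_neg_coe_ennreal_le_one (f x))
      rw [ENNReal.toReal_one] at this
      exact absurd hgt (not_lt.2 (le_trans hx this))
    rw [this, measure_empty]
    exact zero_le

theorem IsGeomConvexIntegrable.volume_sublevel_ne_top {n : ℕ}
    {φ : EuclideanSpace ℝ (Fin n) → ℝ≥0∞} (hφ : IsGeomConvexIntegrable φ) (t : ℝ) :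
    volume {x | φ x ≤ ENNReal.ofReal t} ≠ ∞ := by
  have hm : Measurable fun x => EReal.exp (-(φ x : EReal)) := by
    have := hφ.lowerSemicontinuous.measurable
    fun_prop
  have h := mul_meas_ge_le_lintegral (μ := volume) hm (EReal.exp (-(ENNReal.ofReal t : EReal)))
  refine ne_top_of_le_ne_top ?_ (measure_mono (t := {x | EReal.exp (-(ENNReal.ofReal t : EReal))
    ≤ EReal.exp (-(φ x : EReal))}) fun x hx => ?_)
  · intro htop
    rw [htop, ENNReal.mul_top] at h
    · exact hφ.integral_lt_top.ne (top_le_iff.1 h)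
    · simp
  · exact EReal.exp_monotone (EReal.neg_le_neg_iff.2 (EReal.coe_ennreal_le_coe_ennreal_iff.2 hx))

-- Shrinking towards 0 carries every sublevel set into this one. If it were null, all would be,
-- forcing φ = ∞ almost everywhere and a zero integral.
open scoped Pointwise in
theorem IsGeomConvexIntegrable.volume_sublevel_ne_zero {n : ℕ}
    {φ : EuclideanSpace ℝ (Fin n) → ℝ≥0∞} (hφ : IsGeomConvexIntegrable φ) {t : ℝ} (ht : 0 < t) :
    volume {x | φ x ≤ ENNReal.ofReal t} ≠ 0 := by
  intro h0
  refine hφ.integral_pos.ne' ?_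
  have hnull : ∀ k : ℕ, volume {x | φ x ≤ k} = 0 := fun k => by
    set a : ℝ≥0 := min 1 (t.toNNReal / (k + 1)) with ha
    have ha0 : 0 < a := lt_min one_pos (by positivity)
    have hsub : (a : ℝ) • {x | φ x ≤ k} ⊆ {x | φ x ≤ ENNReal.ofReal t} := by
      rintro _ ⟨x, hx, rfl⟩
      refine (hφ.map_smul_le (min_le_left _ _) x).trans ?_
      calc (a : ℝ≥0∞) * φ x ≤ a * k := by gcongr; exact hx
        _ = ((a * k : ℝ≥0) : ℝ≥0∞) := by push_cast; rfl
        _ ≤ (t.toNNReal : ℝ≥0∞) := by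
          rw [ENNReal.coe_le_coe]
          calc a * k ≤ t.toNNReal / (k + 1) * (k + 1) :=
                mul_le_mul' (min_le_right _ _) (le_add_of_nonneg_right zero_le_one)
            _ = _ := div_mul_cancel₀ _ (by positivity)
    have := measure_mono_null hsub h0
    rw [Measure.addHaar_smul, mul_eq_zero] at this
    refine this.resolve_left ?_
    simp [ha0.ne']
  have hae : ∀ᵐ x, φ x = ∞ := by
    have : ∀ᵐ x, ∀ k : ℕ, ¬ φ x ≤ k := ae_all_iff.2 fun k => by
      rw [ae_iff]
      simpa using hnull k
    filter_upwards [this] with x hx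
    exact ENNReal.eq_top_of_forall_nnreal_le fun r =>
      (ENNReal.coe_le_coe.2 (Nat.le_ceil r)).trans (by simpa using (not_le.1 (hx ⌈r⌉₊)).le)
  rw [integralExpNeg, lintegral_congr_ae (g := fun _ => 0) ?_, lintegral_zero]
  filter_upwards [hae] with x hx
  simp [hx]

/-! ### Reflection and conclusion -/

theorem IsGeomConvex.reflection {n : ℕ} {φ : EuclideanSpace ℝ (Fin n) → ℝ≥0∞}
    (hφ : IsGeomConvex φ) : IsGeomConvex (reflection φ) where
  convexOn := by
    refine ⟨convex_univ, fun x _ y _ a b ha hb hab => ?_⟩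
    have := hφ.convexOn.2 (mem_univ (-x)) (mem_univ (-y)) ha hb hab
    rwa [smul_neg, smul_neg, ← neg_add] at this
  lowerSemicontinuous := fun x a ha => continuous_neg.continuousAt.eventually (hφ.lowerSemicontinuous (-x) a ha)
  map_zero := by rw [_root_.reflection, neg_zero, hφ.map_zero]

theorem integralExpNeg_reflection {n : ℕ} (φ : EuclideanSpace ℝ (Fin n) → ℝ≥0∞) :
    integralExpNeg (reflection φ) = integralExpNeg φ :=
  lintegral_neg_eq_self (μ := volume) fun x => EReal.exp (-(φ x : EReal))

theorem IsGeomConvexIntegrable.reflection {n : ℕ} {φ : EuclideanSpace ℝ (Fin n) → ℝ≥0∞}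
    (hφ : IsGeomConvexIntegrable φ) : IsGeomConvexIntegrable (reflection φ) where
  toIsGeomConvex := hφ.toIsGeomConvex.reflection
  integral_pos := by rw [integralExpNeg_reflection]; exact hφ.integral_pos
  integral_lt_top := by rw [integralExpNeg_reflection]; exact hφ.integral_lt_top

open scoped Pointwise in
theorem mainTheorem5 (n : ℕ) (φ : EuclideanSpace ℝ (Fin n) → ℝ≥0∞)
    (hφ : IsGeomConvexIntegrable φ) :
    IsGeomConvexIntegrable (reflection φ) ∧
      integralExpNeg (gInfConv φ (reflection φ)) ≤ 8 ^ n * integralExpNeg φ := by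
  refine ⟨hφ.reflection, integralExpNeg_le_of_sublevel
    (lowerSemicontinuous_polarity _).measurable hφ.lowerSemicontinuous.measurable
    (by simp) fun t ht => ?_⟩
  set K := {x | φ x ≤ ENNReal.ofReal t} with hK
  have hKc : Convex ℝ K := hφ.convex_sublevel _
  have hKm : MeasurableSet K := hφ.lowerSemicontinuous.measurable measurableSet_Iic
  calc volume {x | gInfConv φ (reflection φ) x ≤ ENNReal.ofReal t}
      ≤ volume ((2 : ℝ) • closure (K - K)) := measure_mono
        (hφ.gInfConv_sublevel_subset hφ.reflection.toIsGeomConvex ht)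
    _ = 2 ^ n * volume (closure (K - K)) := by
        rw [Measure.addHaar_smul, abs_of_pos (by positivity),
          ENNReal.ofReal_pow (by positivity), ENNReal.ofReal_ofNat]
        simp
    -- The frontier of a convex set is null.
    _ = 2 ^ n * volume (K - K) := by
        rw [closure_eq_self_union_frontier, measure_congr
          (union_ae_eq_left_of_ae_eq_empty
            (ae_eq_empty.2 ((hKc.sub hKc).addHaar_frontier volume)))]
    _ ≤ 2 ^ n * (4 ^ n * volume K) := by
        gcongr
        exact volume_sub_self_le hKc hKm (hφ.volume_sublevel_ne_zero ht)
          (hφ.volume_sublevel_ne_top t)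
    _ = 8 ^ n * volume K := by
        rw [← mul_assoc, ← mul_pow]
        norm_num
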